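/- Let $(X,d)$ be a complete separable metric space and let $m$ be a non-negative Borel-regular measure on $X$ with $\operatorname{supp} m=X$ such that, for some $A,B>0$ and $\bar x\in X$, $m(\{x: d(x,\bar x)<r\})\le A e^{Br^2}$ for all $r>0$. For $f\in L^2(X,m)$ let $\mathsf{Ch}(f)=\inf\{\liminf_k \frac12\int_X |\mathsf D f_k|^2\,dm\}$ be the Cheeger energy, where the infimum runs over all sequences $(f_k)$ of Lipschitz functions with bounded support such that $f_k\to f$ in $L^2$, and $|\mathsf D f|(x)=\limsup_{y\to x}|f(y)-f(x)|/d(y,x)$ ($=0$ if $x$ is isolated). Assume that $(X,d,m)$ is infinitesimally Hilbertian, i.e. $2\mathsf{Ch}(f)+2\mathsf{Ch}(g)=\mathsf{Ch}(f+g)+\mathsf{Ch}(f-g)$ whenever $\mathsf{Ch}(f),\mathsf{Ch}(g)<\infty$. Let $-\Delta f$ be the element of minimal norm of the subdifferential $\partial^-\mathsf{Ch}(f)$ (if non-empty), and let $(\mathsf H_t)_{t\ge0}$ be the heat semigroup: for $f\in L^2$, $t\mapsto \mathsf H_tf$ is the unique curve in $L^2$ which is locally Lipschitz on $(0,\infty)$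 and satisfies $\frac{d}{dt}\mathsf H_tf=\Delta \mathsf H_tf$ for a.e. $t>0$ and $\mathsf H_tf\to f$ in $L^2$ as $t\to0^+$; $\mathsf H_t$ is extended to $L^1$ by continuity from $L^2\cap L^1$, and to $L^\infty$ by duality, $\int g\,\mathsf H_tf\,dm=\int f\,\mathsf H_tg\,dm$ for $f\in L^\infty$, $g\in L^1$. Let $c\colon(0,\infty)\to(0,\infty)$ be a Borel function such that, for every $f\in L^\infty$ and $t>0$, $\mathsf H_tf$ has a bounded Lipschitz representative with Lipschitz constant at most $c(t)\|f\|_{L^\infty}$; for bounded $f$ and $t>0$, $\mathsf H_tf$ denotes this continuous representative. Let $\mathscr P_1(X)$ be the set of Borel probability measures with finite first moment, and for finite non-negative Borel measures let $\mathsf W_1(\mu_0,\mu_1)=\sup\{\int f\,d(\mu_0-\mu_1): f \text{ bounded and } 1\text{-Lipschitz}\}\in[0,\infty]$. For a finite signed Borel measure $\mu$, $\mathsf H_t^\star\mu$ denotes the unique finite signed Borel measure $\nu$ such that $\int \mathsf H_tf\,d\mu=\int f\,d\nu$ for all bounded continuous $f$; and $\mathsf h_t[x]$ denotes the density of $\mathsf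 H_t^\star\delta_x$ with respect to $m$. Then the following hold. 1. If $f_0,f_1\in L^1(X,m)$ are non-negative, then $\|\mathsf H_t(f_0-f_1)\|_{L^1}\le c(t)\,\mathsf W_1(f_0m,f_1m)$ for all $t>0$. 2. If $\mu_0,\mu_1\in\mathscr P_1(X)$, then for all $t>0$ the measure $\mathsf H_t^\star(\mu_0-\mu_1)$ is well defined (exists and is unique) and its total variation satisfies $|\mathsf H_t^\star(\mu_0-\mu_1)|(X)\le c(t)\,\mathsf W_1(\mu_0,\mu_1)$. 3. Consequently, for all $x\in X$ and $t>0$ the measure $\mathsf H^\star_t\delta_x$ is well defined and equals $\mathsf h_t[x]\,m$ with $\mathsf h_t[x]\in L^1(X,m)$, and $\|\mathsf h_t[x]-\mathsf h_t[y]\|_{L^1}\le c(t)\,d(x,y)$ for all $x,y\in X$ and $t>0$. -/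

import Mathlib

open MeasureTheory Set Filter Topology
open scoped ENNReal NNReal BoundedContinuousFunction

noncomputable section

namespace MetricHeat

variable {X : Type*} [MetricSpace X] [MeasurableSpace X]

/-- The slope `|D f|(x) = limsup_{y → x} |f y - f x| / d(y, x)`. At an isolated point `𝓝[≠] x = ⊥`,
and the `limsup` (in `[0, ∞]`) is `0`. -/
def slope (f : X → ℝ) (x : X) : ℝ≥0∞ :=
  limsup (fun y => edist (f y) (f x) / edist y x) (𝓝[≠] x)

/-- Lipschitz functions with bounded support. -/
def IsLipBS (f : X → ℝ) : Prop :=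
  (∃ K : ℝ≥0, LipschitzWith K f) ∧ Bornology.IsBounded (Function.support f)

/-- The Cheeger energy, as the `L²`-relaxation of `½ ∫ |D f|² dm` on Lipschitz functions with bounded
support. -/
def cheeger (m : Measure X) (f : Lp ℝ 2 m) : ℝ≥0∞ :=
  ⨅ (F : ℕ → X → ℝ) (_ : ∀ k, IsLipBS (F k))
    (_ : Tendsto (fun k => eLpNorm (fun x => F k x - f x) 2 m) atTop (𝓝 0)),
    liminf (fun k => 2⁻¹ * ∫⁻ x, slope (F k) x ^ 2 ∂m) atTop

/-- `l` belongs to the subdifferential of the Cheeger energy at `f`. (This forces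
`cheeger m f < ∞`, since `cheeger m 0 = 0`.) -/
def IsSubgradient (m : Measure X) (f l : Lp ℝ 2 m) : Prop :=
  ∀ g : Lp ℝ 2 m,
    (cheeger m f : EReal) + ((∫ x, l x * (g - f : Lp ℝ 2 m) x ∂m : ℝ) : EReal)
      ≤ (cheeger m g : EReal)

/-- `f` is in the domain of the Laplacian and `v = Δ f`: the function `v` is the element of minimal
norm of `-∂Ch(f)`. -/
def IsLaplacian (m : Measure X) (f v : Lp ℝ 2 m) : Prop :=
  IsSubgradient m f (-v) ∧ ∀ l : Lp ℝ 2 m, IsSubgradient m f l → ‖v‖ ≤ ‖l‖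

/-- `u` is the heat flow (the `L²`-gradient flow of the Cheeger energy) starting from `f`; only the
values on `[0, ∞)` matter. -/
structure IsHeatFlow (m : Measure X) (f : Lp ℝ 2 m) (u : ℝ → Lp ℝ 2 m) : Prop where
  zero : u 0 = f
  locallyLipschitz : LocallyLipschitzOn (Ioi 0) u
  equation : ∀ᵐ t ∂(volume.restrict (Ioi (0 : ℝ))), ∃ v, IsLaplacian m (u t) v ∧ HasDerivAt u v t
  tendsto : Tendsto u (𝓝[>] 0) (𝓝 f)

open Classical in
/-- The heat semigroup `H_t` on `L²`: the value at time `t` of the unique heat flow from `f`. -/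
def heatL2 (m : Measure X) (t : ℝ) (f : Lp ℝ 2 m) : Lp ℝ 2 m :=
  if h : ∃ u, IsHeatFlow m f u then h.choose t else 0

/-- `L² ∩ L¹`. -/
abbrev L2L1 (m : Measure X) : Type _ := {g : Lp ℝ 2 m // MemLp g 1 m}

/-- The inclusion of `L² ∩ L¹` in `L¹`. -/
def L2L1.toL1 {m : Measure X} (g : L2L1 m) : Lp ℝ 1 m := g.2.toLp g.1

open Classical in
/-- The heat semigroup on `L² ∩ L¹`, with values in `L¹`. -/
def heatL2L1 (m : Measure X) (t : ℝ) (g : L2L1 m) : Lp ℝ 1 m :=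
  if h : MemLp (heatL2 m t g.1) 1 m then h.toLp (heatL2 m t g.1) else 0

/-- The heat semigroup on `L¹`: the extension by continuity of the semigroup on the dense subspace
`L² ∩ L¹`, i.e. the limit of `H_t g` as `g ∈ L² ∩ L¹` tends to `f` in `L¹`. -/
def heatL1 (m : Measure X) (t : ℝ) (f : Lp ℝ 1 m) : Lp ℝ 1 m :=
  limUnder (comap (L2L1.toL1 (m := m)) (𝓝 f)) (heatL2L1 m t)

/-- The function `u` is a version of `H_t f ∈ L^∞`, for `f ∈ L^∞`: the semigroup on `L^∞` is the dual
of the one on `L¹`, that is, `∫ g H_t f dm = ∫ f H_t g dm` for all `g ∈ L¹`. -/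
def IsHeatLinfty (m : Measure X) (t : ℝ) (f u : X → ℝ) : Prop :=
  MemLp u ∞ m ∧ ∀ g : Lp ℝ 1 m, ∫ x, g x * u x ∂m = ∫ x, f x * heatL1 m t g x ∂m

/-- Infinitesimal Hilbertianity: the Cheeger energy satisfies the parallelogram identity on
`W^{1,2} = {Ch < ∞}`. -/
def InfinitesimallyHilbertian (m : Measure X) : Prop :=
  ∀ f g : Lp ℝ 2 m, cheeger m f < ∞ → cheeger m g < ∞ →
    2 * cheeger m f + 2 * cheeger m g = cheeger m (f + g) + cheeger m (f - g)

/-- The growth condition `m(B_r(x₀)) ≤ A exp(B r²)` for all `r > 0`. -/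
def GaussianGrowth (m : Measure X) : Prop :=
  ∃ A B : ℝ, 0 < A ∧ 0 < B ∧ ∃ x₀ : X, ∀ r : ℝ, 0 < r →
    m (Metric.ball x₀ r) ≤ ENNReal.ofReal (A * Real.exp (B * r ^ 2))

/-- The `L^∞`-to-`Lip` contraction property with Lipschitz constant `c`: for every `f ∈ L^∞` and
`t > 0`, `H_t f` has a bounded Lipschitz version `u` with `Lip(u) ≤ c(t) ‖f‖_∞`. -/
def LinftyToLip (m : Measure X) (c : ℝ → ℝ) : Prop :=
  ∀ f : X → ℝ, MemLp f ∞ m → ∀ t : ℝ, 0 < t →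
    ∃ u : X → ℝ, IsHeatLinfty m t f u ∧ (∃ C : ℝ, ∀ x, |u x| ≤ C) ∧
      LipschitzWith (Real.toNNReal (c t * (eLpNorm f ∞ m).toReal)) u

/-- The `1`-Wasserstein distance of finite measures, in `[0, ∞]`: the supremum of
`∫ f d(μ₁ - μ₂)` over bounded `1`-Lipschitz `f`. (The supremum is `≥ 0`, because `f = 0` is
admissible, so truncating at `0` with `ENNReal.ofReal` does not change it.) -/
def W1 (μ₁ μ₂ : Measure X) : ℝ≥0∞ :=
  ⨆ (f : X →ᵇ ℝ) (_ : LipschitzWith 1 f), ENNReal.ofReal (∫ x, f x ∂μ₁ - ∫ x, f x ∂μ₂)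

/-- `μ` has a finite first moment. -/
def HasFiniteFirstMoment (μ : Measure X) : Prop :=
  ∃ x₀ : X, ∫⁻ x, edist x x₀ ∂μ < ∞

/-- `ν = H_t^* μ`: for every bounded continuous `f`, the continuous version `u` of `H_t f` satisfies
`∫ u dμ = ∫ f dν`. -/
def IsDualHeat (m : Measure X) (t : ℝ) (μ ν : SignedMeasure X) : Prop :=
  ∀ f : X →ᵇ ℝ, ∃ u : X →ᵇ ℝ, IsHeatLinfty m t f u ∧ ∫ᵛ x, u x ∂•μ = ∫ᵛ x, f x ∂•ν

open Classical in
/-- The dual heat semigroup `H_t^*` on finite signed measures: the unique `ν` with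
`IsDualHeat m t μ ν`. -/
def dualHeat (m : Measure X) (t : ℝ) (μ : SignedMeasure X) : SignedMeasure X :=
  if h : ∃ ν, IsDualHeat m t μ ν then h.choose else 0

/-- The heat kernel density `h_t[x]`: the density of `H_t^* δ_x` with respect to `m`. -/
def heatKernel (m : Measure X) (t : ℝ) (x : X) : X → ℝ :=
  (dualHeat m t (Measure.dirac x).toSignedMeasure).rnDeriv m

end MetricHeat

end

/-!
The theorem is a duality statement. Write `P_t f` for the continuous version `contHeat m t f` of
`H_t f`; it is unique, hence linear in `f`, because `m` is `σ`-finite with full support. By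
hypothesis `P_t f` is bounded and `c(t)`-Lipschitz whenever `|f| ≤ 1`.

The `L¹` norm of `H_t (f₀ - f₁)` is its integral against a function `s = ± 1` (`signFn`). Duality
moves `H_t` onto `s`, which leaves `∫ P_t s d(f₀ m - f₁ m)`, and `P_t s / c(t)` is admissible in the
definition of `W1`. This is `LinftyToLip.enorm_heatL1_sub_le`; the bound on the total variation of
`H_t^* (μ₀ - μ₁)` is the same computation with `s` given by a Hahn decomposition
(`LinftyToLip.ofReal_sub_compl_le_W1`).

What has to be constructed is the measure `H_t^* μ`, for `μ` finite with finite first moment. It is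
`A ↦ ∫ P_t 1_A dμ`, and its countable additivity rests on one fact
(`LinftyToLip.tendsto_contHeat`): if `f_i → f` pointwise and boundedly then `P_t f_i → P_t f`
pointwise. By duality `H_t f_i → H_t f` weakly-* in `L^∞`; the averages of `P_t f_i` over a small
ball about `x` therefore converge, and equi-Lipschitz continuity compares them with the values at
`x` (`exists_integrable_abs_sub_integral_le`). The same comparison gives
`|P_t f| ≤ C + c(t) d(·, x₀)` uniformly over `|f| ≤ 1`, so that the first moment of `μ` allows
dominated convergence (`LinftyToLip.tendsto_integral_contHeat`). Bounded approximation by simple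
functions then gives `∫ f dH_t^* μ = ∫ P_t f dμ` (`LinftyToLip.integral_eq_integral_contHeat`).
If `m A = 0` then `P_t 1_A = 0`, so these measures are absolutely continuous, and the
Radon-Nikodym theorem yields the heat kernel. The estimate for the kernels is the total variation
bound for two Dirac masses.
-/

noncomputable section

namespace MetricHeat

/-! ### Integrals against signed measures -/

section SignedMeasure

variable {X : Type*} [MeasurableSpace X]

theorem isFiniteMeasure_variation (ν : SignedMeasure X) : IsFiniteMeasure ν.variation := by
  rw [← SignedMeasure.totalVariation_eq_variation]
  unfold SignedMeasure.totalVariation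
  infer_instance

theorem integral_smul_toSignedMeasure (μ : Measure X) [IsFiniteMeasure μ] (f : X → ℝ) :
    ∫ᵛ x, f x ∂•μ.toSignedMeasure = ∫ x, f x ∂μ := by
  have h : (ContinuousLinearMap.lsmul ℝ ℝ : ℝ →L[ℝ] ℝ →L[ℝ] ℝ) =
      (ContinuousLinearMap.lsmul ℝ ℝ : ℝ →L[ℝ] ℝ →L[ℝ] ℝ).flip := by
    ext
    simp
  rw [h, VectorMeasure.integral_toSignedMeasure]

theorem integral_toSignedMeasure_sub (μ₀ μ₁ : Measure X) [IsFiniteMeasure μ₀] [IsFiniteMeasure μ₁]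
    {f : X → ℝ} (h₀ : Integrable f μ₀) (h₁ : Integrable f μ₁) :
    ∫ᵛ x, f x ∂•(μ₀.toSignedMeasure - μ₁.toSignedMeasure) = ∫ x, f x ∂μ₀ - ∫ x, f x ∂μ₁ := by
  rw [VectorMeasure.integral_sub_vectorMeasure (by simpa [VectorMeasure.Integrable] using h₀)
    (by simpa [VectorMeasure.Integrable] using h₁), integral_smul_toSignedMeasure,
    integral_smul_toSignedMeasure]

theorem integrable_variation_of_bounded (ν : SignedMeasure X) {f : X → ℝ} {M : ℝ}
    (hf : Measurable f) (hM : ∀ x, ‖f x‖ ≤ M) : ν.Integrable f :=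
  have := isFiniteMeasure_variation ν
  Integrable.of_bound hf.aestronglyMeasurable M (.of_forall hM)

/-- The total variation of a signed measure is attained on a Hahn decomposition. -/
theorem exists_variation_univ_eq (ν : SignedMeasure X) :
    ∃ P, MeasurableSet P ∧ ν.variation univ = ENNReal.ofReal (ν P - ν Pᶜ) := by
  obtain ⟨P, hP, hpos, hneg, hp, hn⟩ := ν.toJordanDecomposition_spec
  refine ⟨P, hP, ?_⟩
  have h₁ : 0 ≤ ν P := ν.nonneg_of_zero_le_restrict hpos
  have h₂ : ν Pᶜ ≤ 0 := ν.nonpos_of_restrict_le_zero hneg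
  rw [← SignedMeasure.totalVariation_eq_variation, SignedMeasure.totalVariation, hp, hn,
    Measure.add_apply, ν.toMeasureOfZeroLE_apply hpos hP .univ,
    ν.toMeasureOfLEZero_apply hneg hP.compl .univ, sub_eq_add_neg,
    ENNReal.ofReal_add h₁ (neg_nonneg.2 h₂)]
  simp only [inter_univ]
  rw [ENNReal.ofReal_eq_coe_nnreal h₁, ENNReal.ofReal_eq_coe_nnreal (neg_nonneg.2 h₂)]

/-- Bounded continuous functions separate finite signed Borel measures on a metric space. -/
theorem signedMeasure_ext_of_forall_integral_eq {X : Type*} [MetricSpace X] [MeasurableSpace X]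
    [BorelSpace X] {ν ν' : SignedMeasure X}
    (h : ∀ f : X →ᵇ ℝ, ∫ᵛ x, f x ∂•ν = ∫ᵛ x, f x ∂•ν') : ν = ν' := by
  set j := ν.toJordanDecomposition
  set j' := ν'.toJordanDecomposition
  have hj : ν = j.posPart.toSignedMeasure - j.negPart.toSignedMeasure :=
    ν.toSignedMeasure_toJordanDecomposition.symm
  have hj' : ν' = j'.posPart.toSignedMeasure - j'.negPart.toSignedMeasure :=
    ν'.toSignedMeasure_toJordanDecomposition.symm
  -- Moving the negative parts across reduces the claim to two finite positive measures.
  have key : j.posPart + j'.negPart = j'.posPart + j.negPart := by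
    refine ext_of_forall_integral_eq_of_IsFiniteMeasure fun f => ?_
    have := h f
    rw [hj, hj', integral_toSignedMeasure_sub _ _ (f.integrable _) (f.integrable _),
      integral_toSignedMeasure_sub _ _ (f.integrable _) (f.integrable _)] at this
    rw [integral_add_measure (f.integrable _) (f.integrable _),
      integral_add_measure (f.integrable _) (f.integrable _)]
    linarith
  ext s hs
  have : (j.posPart + j'.negPart).real s = (j'.posPart + j.negPart).real s := by rw [key]
  rw [measureReal_add_apply, measureReal_add_apply] at this
  rw [hj, hj', Measure.toSignedMeasure_sub_apply hs, Measure.toSignedMeasure_sub_apply hs]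
  linarith

end SignedMeasure

/-! ### Pairing with functions of modulus one -/

/-- The function equal to `1` on `P` and to `-1` off `P`. -/
def signFn {X : Type*} (P : Set X) : X → ℝ := P.indicator 1 - Pᶜ.indicator 1

theorem abs_indicator_one_le {X : Type*} (A : Set X) (x : X) :
    |A.indicator (1 : X → ℝ) x| ≤ 1 := by
  by_cases h : x ∈ A <;> simp [h]

section signFn

variable {X : Type*} [MeasurableSpace X]

theorem abs_signFn_le {X : Type*} (P : Set X) (x : X) : |signFn P x| ≤ 1 := by
  by_cases h : x ∈ P <;> simp [signFn, h]

theorem measurable_signFn {P : Set X} (hP : MeasurableSet P) : Measurable (signFn P) :=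
  (measurable_one.indicator hP).sub (measurable_one.indicator hP.compl)

theorem signFn_mul_eq_norm {X : Type*} (g : X → ℝ) (x : X) :
    signFn {y | 0 ≤ g y} x * g x = ‖g x‖ := by
  by_cases h : 0 ≤ g x
  · simp [signFn, h, abs_of_nonneg]
  · simp [signFn, h, abs_of_neg (not_le.1 h)]

theorem eLpNorm_one_eq_integral_signFn {m : Measure X} {g : X → ℝ} (hg : Integrable g m) :
    eLpNorm g 1 m = ENNReal.ofReal (∫ x, signFn {y | 0 ≤ g y} x * g x ∂m) := by
  simp only [signFn_mul_eq_norm]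
  rw [eLpNorm_one_eq_lintegral_enorm, ofReal_integral_norm_eq_lintegral_enorm hg]

end signFn

/-! ### Testing the Wasserstein distance on Lipschitz functions -/

section W1

variable {X : Type*} [MetricSpace X] [MeasurableSpace X]

theorem ofReal_integral_sub_le_W1 (μ₀ μ₁ : Measure X) {K : ℝ} (hK : 0 < K) {w : X → ℝ}
    (hw : LipschitzWith K.toNNReal w) (hb : ∃ C, ∀ x, |w x| ≤ C) :
    ENNReal.ofReal (∫ x, w x ∂μ₀ - ∫ x, w x ∂μ₁) ≤ ENNReal.ofReal K * W1 μ₀ μ₁ := by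
  obtain ⟨C, hC⟩ := hb
  let g : X →ᵇ ℝ := K⁻¹ • BoundedContinuousFunction.ofNormedAddCommGroup w hw.continuous C hC
  have hg : ∀ x, g x = K⁻¹ * w x := fun x => rfl
  have hL : LipschitzWith 1 g := by
    refine LipschitzWith.of_dist_le_mul fun x y => ?_
    have := hw.dist_le_mul x y
    rw [Real.coe_toNNReal _ hK.le] at this
    rw [hg, hg, Real.dist_eq, ← mul_sub, abs_mul, abs_of_pos (inv_pos.2 hK), ← Real.dist_eq,
      inv_mul_le_iff₀ hK]
    simpa using this
  have h1 : ∫ x, w x ∂μ₀ - ∫ x, w x ∂μ₁ = K * (∫ x, g x ∂μ₀ - ∫ x, g x ∂μ₁) := by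
    simp only [hg, integral_const_mul]
    field_simp
  rw [h1, ENNReal.ofReal_mul hK.le]
  gcongr
  exact le_iSup₂_of_le g hL le_rfl

theorem W1_dirac_le [BorelSpace X] (x y : X) :
    W1 (Measure.dirac x) (Measure.dirac y) ≤ ENNReal.ofReal (dist x y) := by
  refine iSup₂_le fun f hf => ENNReal.ofReal_le_ofReal ?_
  rw [integral_dirac, integral_dirac]
  have := hf.dist_le_mul x y
  rw [Real.dist_eq] at this
  simpa using (le_abs_self _).trans this

theorem HasFiniteFirstMoment.integrable_dist [BorelSpace X] [TopologicalSpace.SeparableSpace X]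
    {μ : Measure X} [IsFiniteMeasure μ] (h : HasFiniteFirstMoment μ) (x₀ : X) :
    Integrable (fun x => dist x x₀) μ := by
  obtain ⟨x₁, h₁⟩ := h
  have := UniformSpace.secondCountable_of_separable X
  have hi : Integrable (fun x => dist x x₁) μ := by
    refine ⟨by fun_prop, ?_⟩
    simpa [HasFiniteIntegral, edist_dist, Real.enorm_eq_ofReal] using h₁
  refine (hi.add (integrable_const (dist x₁ x₀))).mono' (by fun_prop) (.of_forall fun x => ?_)
  simpa using dist_triangle x x₁ x₀

theorem hasFiniteFirstMoment_dirac [BorelSpace X] (x : X) :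
    HasFiniteFirstMoment (Measure.dirac x) :=
  ⟨x, by simp [lintegral_dirac]⟩

end W1

/-! ### Continuous versions of the heat flow -/

section Bounded

variable {X : Type*} [MeasurableSpace X] {m : Measure X}

theorem memLp_top_of_bounded {f : X → ℝ} {M : ℝ} (hf : Measurable f) (hM : ∀ x, |f x| ≤ M) :
    MemLp f ∞ m :=
  memLp_top_of_bound hf.aestronglyMeasurable M (.of_forall hM)

theorem integrable_L1_mul (g : Lp ℝ 1 m) {f : X → ℝ} (hf : MemLp f ∞ m) :
    Integrable (fun x => g x * f x) m :=
  Integrable.mul_of_top_left (L1.integrable_coeFn g) hf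

theorem integrable_mul_L1 (g : Lp ℝ 1 m) {f : X → ℝ} (hf : MemLp f ∞ m) :
    Integrable (fun x => f x * g x) m := by
  simpa only [mul_comm] using integrable_L1_mul g hf

end Bounded

section Version

variable {X : Type*} [MetricSpace X] [MeasurableSpace X] {m : Measure X} {t : ℝ}

theorem GaussianGrowth.measure_ball_lt_top (h : GaussianGrowth m) (x : X) (r : ℝ) :
    m (Metric.ball x r) < ∞ := by
  obtain ⟨A, B, -, -, x₀, h⟩ := h
  have hpos : 0 < |r| + dist x x₀ + 1 := by positivity
  refine (measure_mono ?_).trans_lt ((h _ hpos).trans_lt ENNReal.ofReal_lt_top)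
  refine Metric.ball_subset_ball' ?_
  linarith [le_abs_self r]

theorem GaussianGrowth.sigmaFinite [TopologicalSpace.SeparableSpace X]
    (h : GaussianGrowth m) : SigmaFinite m := by
  have := UniformSpace.secondCountable_of_separable X
  have : IsLocallyFiniteMeasure m :=
    ⟨fun x => ⟨Metric.ball x 1, Metric.ball_mem_nhds x one_pos, h.measure_ball_lt_top x 1⟩⟩
  infer_instance

theorem IsHeatLinfty.add {f f' u u' : X → ℝ} (h : IsHeatLinfty m t f u)
    (h' : IsHeatLinfty m t f' u') (hf : MemLp f ∞ m) (hf' : MemLp f' ∞ m) :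
    IsHeatLinfty m t (f + f') (u + u') := by
  refine ⟨h.1.add h'.1, fun g => ?_⟩
  simp only [Pi.add_apply, mul_add, add_mul]
  rw [integral_add (integrable_L1_mul g h.1) (integrable_L1_mul g h'.1),
    integral_add (integrable_mul_L1 _ hf) (integrable_mul_L1 _ hf'), h.2, h'.2]

theorem IsHeatLinfty.const_smul {f u : X → ℝ} (h : IsHeatLinfty m t f u) (a : ℝ) :
    IsHeatLinfty m t (a • f) (a • u) := by
  refine ⟨h.1.const_smul a, fun g => ?_⟩
  simp only [Pi.smul_apply, smul_eq_mul, mul_left_comm _ a, mul_assoc a]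
  rw [integral_const_mul, integral_const_mul, h.2]

theorem IsHeatLinfty.congr_ae {f f' u : X → ℝ} (h : IsHeatLinfty m t f u) (hf : f =ᵐ[m] f') :
    IsHeatLinfty m t f' u := by
  refine ⟨h.1, fun g => (h.2 g).trans (integral_congr_ae ?_)⟩
  filter_upwards [hf] with x hx using by rw [hx]

theorem isHeatLinfty_zero : IsHeatLinfty m t 0 0 :=
  ⟨MemLp.zero, fun g => by simp⟩

theorem IsHeatLinfty.ae_eq [SigmaFinite m] {f u u' : X → ℝ}
    (h : IsHeatLinfty m t f u) (h' : IsHeatLinfty m t f u') : u =ᵐ[m] u' := by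
  have hd : MemLp (u - u') ∞ m := h.1.sub h'.1
  have hint : ∀ s, MeasurableSet s → m s < ∞ → IntegrableOn (u - u') s m := fun s _ hs => by
    have : IsFiniteMeasure (m.restrict s) := ⟨by simpa using hs⟩
    exact (hd.restrict s).integrable le_top
  have h0 : u - u' =ᵐ[m] 0 := by
    refine ae_eq_zero_of_forall_setIntegral_eq_of_sigmaFinite hint fun s hs hms => ?_
    let g : Lp ℝ 1 m := indicatorConstLp 1 hs hms.ne 1
    have h1 : ∫ x, g x * (u - u') x ∂m = 0 := by
      simp only [Pi.sub_apply, mul_sub]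
      rw [integral_sub (integrable_L1_mul g h.1) (integrable_L1_mul g h'.1), h.2, h'.2, sub_self]
    rw [← h1, ← integral_indicator hs]
    refine integral_congr_ae ?_
    filter_upwards [indicatorConstLp_coeFn (p := 1) (hs := hs) (hμs := hms.ne) (c := (1 : ℝ))]
      with x hx
    rw [hx]
    by_cases hxs : x ∈ s <;> simp [hxs]
  filter_upwards [h0] with x hx using sub_eq_zero.1 hx

open Classical in
/-- The continuous version of `H_t f`, for bounded `f`. -/
def contHeat (m : Measure X) (t : ℝ) (f : X → ℝ) : X → ℝ :=
  if h : ∃ u, IsHeatLinfty m t f u ∧ Continuous u then h.choose else 0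

variable [m.IsOpenPosMeasure]

/-- The continuous version is unique, because `m` has full support. -/
theorem IsHeatLinfty.contHeat_eq [SigmaFinite m] {f u : X → ℝ} (h : IsHeatLinfty m t f u)
    (hu : Continuous u) : contHeat m t f = u := by
  have hex : ∃ u, IsHeatLinfty m t f u ∧ Continuous u := ⟨u, h, hu⟩
  rw [contHeat, dif_pos hex]
  exact (hex.choose_spec.2.ae_eq_iff_eq m hu).1 (hex.choose_spec.1.ae_eq h)

section Linear

variable [SigmaFinite m] {c : ℝ → ℝ}

theorem LinftyToLip.contHeat_spec (hc : LinftyToLip m c) (ht : 0 < t) (hct : 0 < c t)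
    {f : X → ℝ} {M : ℝ} (hf : Measurable f) (hM : ∀ x, |f x| ≤ M) (hM0 : 0 ≤ M) :
    IsHeatLinfty m t f (contHeat m t f) ∧ (∃ C : ℝ, ∀ x, |contHeat m t f x| ≤ C) ∧
      LipschitzWith (c t * M).toNNReal (contHeat m t f) := by
  obtain ⟨u, hu, hb, hL⟩ := hc f (memLp_top_of_bounded hf hM) t ht
  rw [hu.contHeat_eq hL.continuous]
  refine ⟨hu, hb, hL.weaken (Real.toNNReal_le_toNNReal ?_)⟩
  gcongr
  refine ENNReal.toReal_le_of_le_ofReal hM0 ?_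
  rw [eLpNorm_exponent_top]
  exact eLpNormEssSup_le_of_ae_bound (.of_forall hM)

theorem contHeat_indicator_empty : contHeat m t ((∅ : Set X).indicator 1) = 0 := by
  rw [indicator_empty']
  exact isHeatLinfty_zero.contHeat_eq continuous_zero

theorem LinftyToLip.contHeat_add (hc : LinftyToLip m c) (ht : 0 < t) (hct : 0 < c t)
    {f g : X → ℝ} {M N : ℝ} (hf : Measurable f) (hM : ∀ x, |f x| ≤ M) (hM0 : 0 ≤ M)
    (hg : Measurable g) (hN : ∀ x, |g x| ≤ N) (hN0 : 0 ≤ N) :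
    contHeat m t (f + g) = contHeat m t f + contHeat m t g := by
  obtain ⟨h₁, -, h₁'⟩ := hc.contHeat_spec ht hct hf hM hM0
  obtain ⟨h₂, -, h₂'⟩ := hc.contHeat_spec ht hct hg hN hN0
  exact (h₁.add h₂ (memLp_top_of_bounded hf hM) (memLp_top_of_bounded hg hN)).contHeat_eq
    (h₁'.continuous.add h₂'.continuous)

theorem LinftyToLip.contHeat_const_smul (hc : LinftyToLip m c) (ht : 0 < t) (hct : 0 < c t)
    {f : X → ℝ} {M : ℝ} (hf : Measurable f) (hM : ∀ x, |f x| ≤ M) (hM0 : 0 ≤ M) (a : ℝ) :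
    contHeat m t (a • f) = a • contHeat m t f := by
  obtain ⟨h₁, -, h₁'⟩ := hc.contHeat_spec ht hct hf hM hM0
  exact (h₁.const_smul a).contHeat_eq (h₁'.continuous.const_smul a)

theorem LinftyToLip.sum_contHeat_indicator (hc : LinftyToLip m c) (ht : 0 < t) (hct : 0 < c t)
    {A : ℕ → Set X} (hA : ∀ i, MeasurableSet (A i)) (hd : Pairwise (Function.onFun Disjoint A))
    (s : Finset ℕ) :
    contHeat m t ((⋃ i ∈ s, A i).indicator 1) = ∑ i ∈ s, contHeat m t ((A i).indicator 1) := by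
  induction s using Finset.induction_on with
  | empty => simpa only [Finset.notMem_empty, iUnion_of_empty, iUnion_empty, Finset.sum_empty]
      using contHeat_indicator_empty
  | insert j s hj ih =>
    have hdisj : Disjoint (A j) (⋃ i ∈ s, A i) :=
      disjoint_iUnion₂_right.2 fun i hi => hd fun hji => hj (hji ▸ hi)
    rw [Finset.sum_insert hj, ← ih, Finset.set_biUnion_insert, indicator_union_of_disjoint hdisj]
    exact hc.contHeat_add ht hct (measurable_one.indicator (hA j)) (abs_indicator_one_le _)
      zero_le_one (measurable_one.indicator (s.measurableSet_biUnion fun i _ => hA i))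
      (abs_indicator_one_le _) zero_le_one

end Linear

variable [BorelSpace X]

/-- Up to an error `K r`, the value at `x` of a `K`-Lipschitz version of `H_t f` is the integral of
`f` against one integrable function independent of `f`: the image under `H_t` of the normalized
indicator of the ball of radius `r` about `x`. -/
theorem exists_integrable_abs_sub_integral_le (hgrowth : GaussianGrowth m) (t : ℝ) (x : X)
    {r : ℝ} (hr : 0 < r) :
    ∃ h : Lp ℝ 1 m, ∀ (f u : X → ℝ) (K : ℝ≥0), IsHeatLinfty m t f u → LipschitzWith K u →
      |u x - ∫ y, f y * h y ∂m| ≤ K * r := by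
  set B := Metric.ball x r
  have hfin : m B < ∞ := hgrowth.measure_ball_lt_top x r
  have hpos : 0 < m.real B := ENNReal.toReal_pos (Metric.measure_ball_pos m x hr).ne' hfin.ne
  let g : Lp ℝ 1 m := indicatorConstLp 1 measurableSet_ball hfin.ne (m.real B)⁻¹
  refine ⟨heatL1 m t g, fun f u K hu hL => ?_⟩
  have hui : IntegrableOn u B m := by
    have : IsFiniteMeasure (m.restrict B) := ⟨by simpa using hfin⟩
    exact (hu.1.restrict B).integrable le_top
  have h1 : ∫ y, g y * u y ∂m = (m.real B)⁻¹ * ∫ y in B, u y ∂m := by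
    rw [← integral_const_mul, ← integral_indicator measurableSet_ball]
    refine integral_congr_ae ?_
    filter_upwards [indicatorConstLp_coeFn (p := 1) (hs := measurableSet_ball) (hμs := hfin.ne)
      (c := (m.real B)⁻¹)] with y hy
    rw [hy]
    by_cases hyB : y ∈ B <;> simp [hyB, B]
  have h2 : u x - ∫ y, f y * heatL1 m t g y ∂m =
      (m.real B)⁻¹ * ∫ y in B, (u x - u y) ∂m := by
    rw [← hu.2, h1,
      integral_sub (integrableOn_const hfin.ne : IntegrableOn (fun _ => u x) B m) hui,
      setIntegral_const, smul_eq_mul, mul_sub, inv_mul_cancel_left₀ hpos.ne']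
  have h3 : ‖∫ y in B, (u x - u y) ∂m‖ ≤ K * r * m.real B := by
    refine norm_setIntegral_le_of_norm_le_const hfin fun y hy => ?_
    rw [← dist_eq_norm]
    refine (hL.dist_le_mul x y).trans ?_
    gcongr
    exact (Metric.mem_ball'.1 hy).le
  rw [h2, abs_mul, abs_of_pos (inv_pos.2 hpos), inv_mul_le_iff₀ hpos, mul_comm (m.real B)]
  exact h3

variable [SigmaFinite m] {c : ℝ → ℝ}

/-- Bounded pointwise convergence passes through the continuous versions: the functions are
equi-Lipschitz and converge weakly-* in `L^∞`, hence pointwise. -/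
theorem LinftyToLip.tendsto_contHeat (hc : LinftyToLip m c) (hgrowth : GaussianGrowth m)
    (ht : 0 < t) (hct : 0 < c t) {ι : Type*} {l : Filter ι} [l.IsCountablyGenerated]
    {F : ι → X → ℝ} {f : X → ℝ} {M : ℝ} (hM0 : 0 ≤ M)
    (hF : ∀ i, Measurable (F i)) (hFM : ∀ i x, |F i x| ≤ M)
    (hf : Measurable f) (hfM : ∀ x, |f x| ≤ M)
    (hlim : ∀ x, Tendsto (fun i => F i x) l (𝓝 (f x))) (x : X) :
    Tendsto (fun i => contHeat m t (F i) x) l (𝓝 (contHeat m t f x)) := by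
  rw [Metric.tendsto_nhds]
  intro ε hε
  -- The two Lipschitz errors are each at most `ε / 3` for this radius.
  set r := ε / (3 * (c t * M + 1))
  have hcM : 0 ≤ c t * M := by positivity
  have hr : 0 < r := by positivity
  have hKr : ((c t * M).toNNReal : ℝ) * r ≤ ε / 3 := by
    rw [Real.coe_toNNReal _ hcM]
    have : (c t * M + 1) * r = ε / 3 := by simp only [r]; field_simp
    nlinarith
  obtain ⟨h, hh⟩ := exists_integrable_abs_sub_integral_le hgrowth t x hr
  have hI : Tendsto (fun i => ∫ y, F i y * h y ∂m) l (𝓝 (∫ y, f y * h y ∂m)) := by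
    refine tendsto_integral_filter_of_dominated_convergence (fun y => M * ‖h y‖)
      (.of_forall fun i => (hF i).aestronglyMeasurable.mul (Lp.aestronglyMeasurable h))
      (.of_forall fun i => .of_forall fun y => ?_) ((L1.integrable_coeFn h).norm.const_mul M)
      (.of_forall fun y => (hlim y).mul_const _)
    rw [norm_mul]
    gcongr
    exact hFM i y
  obtain ⟨hu, -, hL⟩ := hc.contHeat_spec ht hct hf hfM hM0
  have e₂ := abs_le.1 ((hh _ _ _ hu hL).trans hKr)
  filter_upwards [Metric.tendsto_nhds.1 hI (ε / 3) (by positivity)] with i hi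
  obtain ⟨hui, -, hLi⟩ := hc.contHeat_spec ht hct (hF i) (hFM i) hM0
  have e₁ := abs_le.1 ((hh _ _ _ hui hLi).trans hKr)
  rw [Real.dist_eq, abs_lt] at hi ⊢
  constructor <;> linarith [e₁.1, e₁.2, e₂.1, e₂.2, hi.1, hi.2]

/-- Uniformly over `|f| ≤ M`, the continuous version of `H_t f` grows at most linearly in the
distance from a base point. -/
theorem LinftyToLip.exists_abs_contHeat_le (hc : LinftyToLip m c) (hgrowth : GaussianGrowth m)
    (ht : 0 < t) (hct : 0 < c t) {M : ℝ} (hM0 : 0 ≤ M) (x₀ : X) :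
    ∃ C, ∀ f : X → ℝ, Measurable f → (∀ x, |f x| ≤ M) →
      ∀ x, |contHeat m t f x| ≤ C + c t * M * dist x x₀ := by
  obtain ⟨h, hh⟩ := exists_integrable_abs_sub_integral_le hgrowth t x₀ one_pos
  refine ⟨c t * M * 1 + M * ∫ y, ‖h y‖ ∂m, fun f hf hfM x => ?_⟩
  obtain ⟨hu, -, hL⟩ := hc.contHeat_spec ht hct hf hfM hM0
  have hcM : 0 ≤ c t * M := by positivity
  have h₁ := hh _ _ _ hu hL
  have h₂ := hL.dist_le_mul x x₀
  rw [Real.coe_toNNReal _ hcM] at h₁ h₂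
  rw [Real.dist_eq] at h₂
  have h₃ : |∫ y, f y * h y ∂m| ≤ M * ∫ y, ‖h y‖ ∂m := by
    rw [← integral_const_mul, ← Real.norm_eq_abs]
    refine norm_integral_le_of_norm_le ((L1.integrable_coeFn h).norm.const_mul M)
      (.of_forall fun y => ?_)
    rw [norm_mul]
    gcongr
    exact hfM y
  have h₄ := abs_sub_abs_le_abs_sub (contHeat m t f x) (contHeat m t f x₀)
  have h₅ := abs_sub_abs_le_abs_sub (contHeat m t f x₀) (∫ y, f y * h y ∂m)
  linarith

end Version

/-! ### The contraction on integrable functions -/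

section Sign

variable {X : Type*} [MetricSpace X] [MeasurableSpace X] {m : Measure X} {t : ℝ} {c : ℝ → ℝ}
  [SigmaFinite m] [m.IsOpenPosMeasure]

theorem LinftyToLip.contHeat_signFn (hc : LinftyToLip m c) (ht : 0 < t) (hct : 0 < c t) {P : Set X}
    (hP : MeasurableSet P) :
    contHeat m t (signFn P) =
      contHeat m t (P.indicator 1) - contHeat m t (Pᶜ.indicator 1) := by
  have h₁ : Measurable (P.indicator (1 : X → ℝ)) := measurable_one.indicator hP
  have h₂ : Measurable (Pᶜ.indicator (1 : X → ℝ)) := measurable_one.indicator hP.compl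
  have e : signFn P = P.indicator 1 + (-1 : ℝ) • Pᶜ.indicator 1 := by
    rw [signFn, neg_one_smul, sub_eq_add_neg]
  have hb : ∀ x, |((-1 : ℝ) • Pᶜ.indicator (1 : X → ℝ)) x| ≤ 1 := fun x => by
    simpa using abs_indicator_one_le Pᶜ x
  rw [e, hc.contHeat_add ht hct h₁ (abs_indicator_one_le P) zero_le_one (h₂.const_smul _) hb
    zero_le_one, hc.contHeat_const_smul ht hct h₂ (abs_indicator_one_le _) zero_le_one,
    neg_one_smul, sub_eq_add_neg]

/-- The `L¹` contraction, by duality: the norm of `H_t g` is its pairing with a function `f = ± 1`,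
and the pairing moves `H_t` onto `f`, where it produces a `c(t)`-Lipschitz function. -/
theorem LinftyToLip.enorm_heatL1_sub_le (hc : LinftyToLip m c) (ht : 0 < t)
    (hct : 0 < c t) {f₀ f₁ : Lp ℝ 1 m} (h₀ : 0 ≤ f₀) (h₁ : 0 ≤ f₁) :
    ‖heatL1 m t (f₀ - f₁)‖ₑ ≤ ENNReal.ofReal (c t) *
      W1 (m.withDensity fun x => ENNReal.ofReal (f₀ x))
        (m.withDensity fun x => ENNReal.ofReal (f₁ x)) := by
  set G := heatL1 m t (f₀ - f₁)
  set P : Set X := {y | 0 ≤ G y}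
  have hP : MeasurableSet P :=
    measurableSet_le measurable_const (Lp.stronglyMeasurable G).measurable
  obtain ⟨hu, hb, hL⟩ :=
    hc.contHeat_spec ht hct (measurable_signFn hP) (abs_signFn_le P) zero_le_one
  rw [mul_one] at hL
  rw [Lp.enorm_def, eLpNorm_one_eq_integral_signFn (L1.integrable_coeFn G)]
  refine le_of_eq_of_le (congrArg _ ?_) (ofReal_integral_sub_le_W1 _ _ hct hL hb)
  have key : ∀ g : Lp ℝ 1 m, 0 ≤ g →
      ∫ x, contHeat m t (signFn P) x ∂(m.withDensity fun x => ENNReal.ofReal (g x)) =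
        ∫ x, g x * contHeat m t (signFn P) x ∂m := fun g hg => by
    rw [integral_withDensity_eq_integral_toReal_smul
      (Lp.stronglyMeasurable g).measurable.ennreal_ofReal
      (.of_forall fun _ => ENNReal.ofReal_lt_top)]
    refine integral_congr_ae ?_
    filter_upwards [(Lp.coeFn_nonneg g).2 hg] with x hx
    rw [ENNReal.toReal_ofReal hx, smul_eq_mul]
  rw [key f₀ h₀, key f₁ h₁, ← hu.2 (f₀ - f₁),
    ← integral_sub (integrable_L1_mul f₀ hu.1) (integrable_L1_mul f₁ hu.1)]
  refine integral_congr_ae ?_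
  filter_upwards [Lp.coeFn_sub f₀ f₁] with x hx
  rw [hx, Pi.sub_apply, sub_mul]

end Sign

/-! ### The dual heat flow -/

section Dual

variable {X : Type*} [MetricSpace X] [MeasurableSpace X] {m : Measure X} {t : ℝ}

/-- A set function given by integrating `H_t 1_A` does not charge `m`-null sets. -/
theorem absolutelyContinuous_of_eq_integral_contHeat [SigmaFinite m] [m.IsOpenPosMeasure]
    {μ : Measure X} {ν : SignedMeasure X}
    (hν : ∀ A, MeasurableSet A → ν A = ∫ x, contHeat m t (A.indicator 1) x ∂μ) :
    ν ≪ᵥ m.toENNRealVectorMeasure := by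
  refine VectorMeasure.AbsolutelyContinuous.mk fun A hA hmA => ?_
  rw [Measure.toENNRealVectorMeasure_apply_measurable hA] at hmA
  have h0 : IsHeatLinfty m t (A.indicator 1) 0 :=
    isHeatLinfty_zero.congr_ae (indicator_meas_zero hmA).symm
  rw [hν A hA, h0.contHeat_eq continuous_zero]
  simp


theorem IsDualHeat.eq [BorelSpace X] [SigmaFinite m] [m.IsOpenPosMeasure] {μ ν ν' : SignedMeasure X}
    (h : IsDualHeat m t μ ν) (h' : IsDualHeat m t μ ν') : ν = ν' := by
  refine signedMeasure_ext_of_forall_integral_eq fun f => ?_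
  obtain ⟨u, hu, e⟩ := h f
  obtain ⟨u', hu', e'⟩ := h' f
  have : u = u' := DFunLike.coe_injective ((hu.contHeat_eq u.continuous).symm.trans
    (hu'.contHeat_eq u'.continuous))
  rw [← e, ← e', this]

theorem IsDualHeat.dualHeat_eq [BorelSpace X] [SigmaFinite m] [m.IsOpenPosMeasure]
    {μ ν : SignedMeasure X} (h : IsDualHeat m t μ ν) : dualHeat m t μ = ν := by
  have hex : ∃ ν, IsDualHeat m t μ ν := ⟨ν, h⟩
  rw [dualHeat, dif_pos hex]
  exact hex.choose_spec.eq h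

theorem IsDualHeat.sub [BorelSpace X] [SigmaFinite m] [m.IsOpenPosMeasure]
    {μ₀ μ₁ ν₀ ν₁ : SignedMeasure X} (h₀ : IsDualHeat m t μ₀ ν₀) (h₁ : IsDualHeat m t μ₁ ν₁) :
    IsDualHeat m t (μ₀ - μ₁) (ν₀ - ν₁) := by
  intro f
  obtain ⟨u, hu, e⟩ := h₀ f
  obtain ⟨u', hu', e'⟩ := h₁ f
  have huu : u = u' := DFunLike.coe_injective ((hu.contHeat_eq u.continuous).symm.trans
    (hu'.contHeat_eq u'.continuous))
  subst huu
  have hi : ∀ (g : X →ᵇ ℝ) (ξ : SignedMeasure X), ξ.Integrable g := fun g ξ =>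
    integrable_variation_of_bounded ξ g.continuous.measurable g.norm_coe_le_norm
  refine ⟨u, hu, ?_⟩
  rw [VectorMeasure.integral_sub_vectorMeasure (hi u _) (hi u _),
    VectorMeasure.integral_sub_vectorMeasure (hi f _) (hi f _), e, e']

variable [BorelSpace X] [TopologicalSpace.SeparableSpace X] [m.IsOpenPosMeasure] [SigmaFinite m]
  {c : ℝ → ℝ}

theorem LinftyToLip.integrable_contHeat (hc : LinftyToLip m c) (ht : 0 < t) (hct : 0 < c t)
    (μ : Measure X) [IsFiniteMeasure μ] {f : X → ℝ} {M : ℝ} (hf : Measurable f)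
    (hM : ∀ x, |f x| ≤ M) (hM0 : 0 ≤ M) : Integrable (contHeat m t f) μ := by
  have := UniformSpace.secondCountable_of_separable X
  obtain ⟨-, ⟨C, hC⟩, hL⟩ := hc.contHeat_spec ht hct hf hM hM0
  exact Integrable.of_bound hL.continuous.aestronglyMeasurable C (.of_forall hC)

/-- Bounded pointwise convergence passes through the functional `f ↦ ∫ H_t f dμ`; the finite first
moment makes the linear growth bound on the versions an integrable majorant. -/
theorem LinftyToLip.tendsto_integral_contHeat (hc : LinftyToLip m c) (hgrowth : GaussianGrowth m)
    (ht : 0 < t) (hct : 0 < c t) {μ : Measure X} [IsFiniteMeasure μ] (hμ : HasFiniteFirstMoment μ)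
    {ι : Type*} {l : Filter ι} [l.IsCountablyGenerated]
    {F : ι → X → ℝ} {f : X → ℝ} {M : ℝ} (hM0 : 0 ≤ M)
    (hF : ∀ i, Measurable (F i)) (hFM : ∀ i x, |F i x| ≤ M)
    (hf : Measurable f) (hfM : ∀ x, |f x| ≤ M)
    (hlim : ∀ x, Tendsto (fun i => F i x) l (𝓝 (f x))) :
    Tendsto (fun i => ∫ x, contHeat m t (F i) x ∂μ) l (𝓝 (∫ x, contHeat m t f x ∂μ)) := by
  obtain ⟨x₀, -⟩ := id hμ
  obtain ⟨C, hC⟩ := hc.exists_abs_contHeat_le hgrowth ht hct hM0 x₀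
  exact tendsto_integral_filter_of_dominated_convergence (fun x => C + c t * M * dist x x₀)
    (.of_forall fun i => (hc.integrable_contHeat ht hct μ (hF i) (hFM i) hM0).aestronglyMeasurable)
    (.of_forall fun i => .of_forall (hC _ (hF i) (hFM i)))
    ((integrable_const C).add ((hμ.integrable_dist x₀).const_mul _))
    (.of_forall (hc.tendsto_contHeat hgrowth ht hct hM0 hF hFM hf hfM hlim))

/-- The set function `A ↦ ∫ H_t 1_A dμ` is a signed measure. -/
theorem LinftyToLip.exists_signedMeasure (hc : LinftyToLip m c) (hgrowth : GaussianGrowth m)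
    (ht : 0 < t) (hct : 0 < c t) {μ : Measure X} [IsFiniteMeasure μ]
    (hμ : HasFiniteFirstMoment μ) :
    ∃ ν : SignedMeasure X, ∀ A, MeasurableSet A →
      ν A = ∫ x, contHeat m t (A.indicator 1) x ∂μ := by
  classical
  refine ⟨{ measureOf' := fun A =>
              if MeasurableSet A then ∫ x, contHeat m t (A.indicator 1) x ∂μ else 0
            empty' := by
              simp only [MeasurableSet.empty, if_true, contHeat_indicator_empty, Pi.zero_apply,
                integral_zero]
            not_measurable' := fun _ hA => if_neg hA
            m_iUnion' := fun A hA hd => ?_ }, fun A hA => if_pos hA⟩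
  simp only [hA, MeasurableSet.iUnion hA, if_true]
  have hsum : ∀ s : Finset ℕ, ∑ i ∈ s, ∫ x, contHeat m t ((A i).indicator 1) x ∂μ =
      ∫ x, contHeat m t ((⋃ i ∈ s, A i).indicator 1) x ∂μ := fun s => by
    rw [hc.sum_contHeat_indicator ht hct hA hd, ← integral_finsetSum]
    · simp
    · exact fun i _ => hc.integrable_contHeat ht hct μ (measurable_one.indicator (hA i))
        (abs_indicator_one_le _) zero_le_one
  simp only [HasSum, SummationFilter.unconditional_filter, hsum]
  exact hc.tendsto_integral_contHeat hgrowth ht hct hμ zero_le_one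
    (fun s => measurable_one.indicator (s.measurableSet_biUnion fun i _ => hA i))
    (fun _ => abs_indicator_one_le _) (measurable_one.indicator (.iUnion hA))
    (abs_indicator_one_le _)
    (fun x => (tendsto_indicator_biUnion_finset A 1 x).mono_right (pure_le_nhds _))

/-- The duality extends from indicators to bounded measurable functions, by linearity and bounded
pointwise approximation. -/
theorem LinftyToLip.integral_eq_integral_contHeat (hc : LinftyToLip m c)
    (hgrowth : GaussianGrowth m) (ht : 0 < t) (hct : 0 < c t) {μ : Measure X} [IsFiniteMeasure μ]
    (hμ : HasFiniteFirstMoment μ) {ν : SignedMeasure X}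
    (hν : ∀ A, MeasurableSet A → ν A = ∫ x, contHeat m t (A.indicator 1) x ∂μ)
    {f : X → ℝ} {M : ℝ} (hf : Measurable f) (hM : ∀ x, |f x| ≤ M) (hM0 : 0 ≤ M) :
    ∫ᵛ x, f x ∂•ν = ∫ x, contHeat m t f x ∂μ := by
  have := isFiniteMeasure_variation ν
  have hsb : ∀ g : SimpleFunc X ℝ, ∃ N, 0 ≤ N ∧ ∀ x, |g x| ≤ N := fun g => by
    obtain ⟨N, hN⟩ := g.exists_forall_norm_le
    exact ⟨max N 0, le_max_right _ _, fun x => (hN x).trans (le_max_left _ _)⟩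
  have hsimple : ∀ g : SimpleFunc X ℝ, ∫ᵛ x, g x ∂•ν = ∫ x, contHeat m t g x ∂μ := by
    intro g
    induction g using SimpleFunc.induction with
    | const a hs =>
      rename_i s
      have e : (SimpleFunc.piecewise s hs (SimpleFunc.const X a) (SimpleFunc.const X 0) : X → ℝ) =
          a • s.indicator 1 := by
        ext x
        by_cases hx : x ∈ s <;> simp [hx]
      have e' : (a • s.indicator 1 : X → ℝ) = s.indicator fun _ => a := by
        ext x
        by_cases hx : x ∈ s <;> simp [hx]
      rw [e, hc.contHeat_const_smul ht hct (measurable_one.indicator hs) (abs_indicator_one_le _)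
        zero_le_one a, e']
      have : IsFiniteMeasure (ν.variation.restrict s) := inferInstance
      rw [VectorMeasure.integral_indicator hs, VectorMeasure.setIntegral_const, hν s hs]
      simp [integral_const_mul]
    | add _ ihg ihh =>
      rename_i g h _
      obtain ⟨N, hN0, hN⟩ := hsb g
      obtain ⟨N', hN0', hN'⟩ := hsb h
      rw [SimpleFunc.coe_add, hc.contHeat_add ht hct g.measurable hN hN0 h.measurable hN' hN0']
      simp only [Pi.add_apply]
      rw [integral_add (hc.integrable_contHeat ht hct μ g.measurable hN hN0)
          (hc.integrable_contHeat ht hct μ h.measurable hN' hN0'), ← ihg, ← ihh,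
        VectorMeasure.integral_fun_add (integrable_variation_of_bounded ν g.measurable hN)
          (integrable_variation_of_bounded ν h.measurable hN')]
  have hfs := hf.stronglyMeasurable
  have l₁ : Tendsto (fun n => ∫ᵛ x, hfs.approxBounded M n x ∂•ν) atTop (𝓝 (∫ᵛ x, f x ∂•ν)) :=
    VectorMeasure.tendsto_integral_filter_of_dominated_convergence (fun _ => M)
      (.of_forall fun n => (SimpleFunc.stronglyMeasurable _).aestronglyMeasurable)
      (.of_forall fun n => .of_forall (hfs.norm_approxBounded_le hM0 n)) (integrable_const M)
      (.of_forall fun x => hfs.tendsto_approxBounded_of_norm_le (hM x))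
  have l₂ := hc.tendsto_integral_contHeat hgrowth ht hct hμ hM0
    (fun n => (hfs.approxBounded M n).measurable) (fun n => hfs.norm_approxBounded_le hM0 n) hf hM
    (fun x => hfs.tendsto_approxBounded_of_norm_le (hM x))
  simp only [hsimple] at l₁
  exact tendsto_nhds_unique l₁ l₂

theorem LinftyToLip.isDualHeat (hc : LinftyToLip m c) (hgrowth : GaussianGrowth m) (ht : 0 < t)
    (hct : 0 < c t) {μ : Measure X} [IsFiniteMeasure μ] (hμ : HasFiniteFirstMoment μ)
    {ν : SignedMeasure X}
    (hν : ∀ A, MeasurableSet A → ν A = ∫ x, contHeat m t (A.indicator 1) x ∂μ) :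
    IsDualHeat m t μ.toSignedMeasure ν := by
  intro f
  obtain ⟨hu, ⟨C, hC⟩, hL⟩ :=
    hc.contHeat_spec ht hct f.continuous.measurable f.norm_coe_le_norm (norm_nonneg f)
  refine ⟨BoundedContinuousFunction.ofNormedAddCommGroup _ hL.continuous C hC, hu, ?_⟩
  rw [hc.integral_eq_integral_contHeat hgrowth ht hct hμ hν f.continuous.measurable
    f.norm_coe_le_norm (norm_nonneg f)]
  exact integral_smul_toSignedMeasure _ _

/-- For two dual flows `ν₀`, `ν₁`, the difference `(ν₀ - ν₁)(P) - (ν₀ - ν₁)(Pᶜ)` is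
`∫ H_t f d(μ₀ - μ₁)` with `f = ± 1`, and `H_t f` is `c(t)`-Lipschitz. -/
theorem LinftyToLip.ofReal_sub_compl_le_W1 (hc : LinftyToLip m c) (ht : 0 < t)
    (hct : 0 < c t) {μ₀ μ₁ : Measure X} [IsFiniteMeasure μ₀] [IsFiniteMeasure μ₁]
    {ν₀ ν₁ : SignedMeasure X}
    (hν₀ : ∀ A, MeasurableSet A → ν₀ A = ∫ x, contHeat m t (A.indicator 1) x ∂μ₀)
    (hν₁ : ∀ A, MeasurableSet A → ν₁ A = ∫ x, contHeat m t (A.indicator 1) x ∂μ₁)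
    {P : Set X} (hP : MeasurableSet P) :
    ENNReal.ofReal ((ν₀ - ν₁) P - (ν₀ - ν₁) Pᶜ) ≤ ENNReal.ofReal (c t) * W1 μ₀ μ₁ := by
  obtain ⟨-, hb, hL⟩ :=
    hc.contHeat_spec ht hct (measurable_signFn hP) (abs_signFn_le P) zero_le_one
  rw [mul_one] at hL
  refine le_of_eq_of_le (congrArg _ ?_) (ofReal_integral_sub_le_W1 μ₀ μ₁ hct hL hb)
  have hi : ∀ (μ : Measure X) [IsFiniteMeasure μ] (A : Set X), MeasurableSet A →
      Integrable (contHeat m t (A.indicator 1)) μ := fun μ _ A hA =>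
    hc.integrable_contHeat ht hct μ (measurable_one.indicator hA) (abs_indicator_one_le A)
      zero_le_one
  rw [hc.contHeat_signFn ht hct hP]
  simp only [Pi.sub_apply, sub_apply]
  rw [integral_sub (hi μ₀ P hP) (hi μ₀ Pᶜ hP.compl), integral_sub (hi μ₁ P hP) (hi μ₁ Pᶜ hP.compl),
    hν₀ P hP, hν₀ Pᶜ hP.compl, hν₁ P hP, hν₁ Pᶜ hP.compl]
  ring

end Dual

end MetricHeat

end

theorem mainTheorem9 {X : Type*} [MetricSpace X] [CompleteSpace X]
    [TopologicalSpace.SeparableSpace X] [MeasurableSpace X] [BorelSpace X]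
    (m : Measure X) [m.IsOpenPosMeasure]
    (hgrowth : MetricHeat.GaussianGrowth m)
    (hhilb : MetricHeat.InfinitesimallyHilbertian m)
    (c : ℝ → ℝ) (hc_meas : Measurable (fun t : Ioi (0 : ℝ) => c t)) (hc_pos : ∀ t, 0 < t → 0 < c t)
    (hc : MetricHeat.LinftyToLip m c) :
    (∀ f₀ f₁ : Lp ℝ 1 m, 0 ≤ f₀ → 0 ≤ f₁ → ∀ t : ℝ, 0 < t →
      ‖MetricHeat.heatL1 m t (f₀ - f₁)‖ₑ ≤
        ENNReal.ofReal (c t) *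
          MetricHeat.W1 (m.withDensity fun x => ENNReal.ofReal (f₀ x))
            (m.withDensity fun x => ENNReal.ofReal (f₁ x))) ∧
    (∀ (μ₀ μ₁ : Measure X) [IsProbabilityMeasure μ₀] [IsProbabilityMeasure μ₁],
      MetricHeat.HasFiniteFirstMoment μ₀ → MetricHeat.HasFiniteFirstMoment μ₁ →
      ∀ t : ℝ, 0 < t →
        (∃! ν : SignedMeasure X,
          MetricHeat.IsDualHeat m t (μ₀.toSignedMeasure - μ₁.toSignedMeasure) ν) ∧
        (MetricHeat.dualHeat m t (μ₀.toSignedMeasure - μ₁.toSignedMeasure)).variation univ ≤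
          ENNReal.ofReal (c t) * MetricHeat.W1 μ₀ μ₁) ∧
    (∀ (x : X) (t : ℝ), 0 < t →
      (∃! ν : SignedMeasure X,
        MetricHeat.IsDualHeat m t (Measure.dirac x).toSignedMeasure ν) ∧
      Integrable (MetricHeat.heatKernel m t x) m ∧
      MetricHeat.dualHeat m t (Measure.dirac x).toSignedMeasure =
        m.withDensityᵥ (MetricHeat.heatKernel m t x)) ∧
    (∀ (x y : X) (t : ℝ), 0 < t →
      eLpNorm (MetricHeat.heatKernel m t x - MetricHeat.heatKernel m t y) 1 m ≤
        ENNReal.ofReal (c t * dist x y)) := by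
  have := hgrowth.sigmaFinite
  -- A Dirac mass has finite first moment, so its dual flow exists; it has a density.
  have hdirac : ∀ (x : X) (t : ℝ), 0 < t → ∃ ν : SignedMeasure X,
      (∀ A, MeasurableSet A →
        ν A = ∫ y, MetricHeat.contHeat m t (A.indicator 1) y ∂(Measure.dirac x)) ∧
      MetricHeat.IsDualHeat m t (Measure.dirac x).toSignedMeasure ν ∧
      ν = m.withDensityᵥ (MetricHeat.heatKernel m t x) := by
    intro x t ht
    have hx := MetricHeat.hasFiniteFirstMoment_dirac x
    obtain ⟨ν, hν⟩ := hc.exists_signedMeasure hgrowth ht (hc_pos t ht) hx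
    have hd := hc.isDualHeat hgrowth ht (hc_pos t ht) hx hν
    refine ⟨ν, hν, hd, ?_⟩
    rw [MetricHeat.heatKernel, hd.dualHeat_eq]
    exact (SignedMeasure.withDensityᵥ_rnDeriv_eq ν m
      (MetricHeat.absolutelyContinuous_of_eq_integral_contHeat hν)).symm
  have hint : ∀ (x : X) (t : ℝ), Integrable (MetricHeat.heatKernel m t x) m := fun x t =>
    SignedMeasure.integrable_rnDeriv _ _
  refine ⟨fun f₀ f₁ h₀ h₁ t ht => hc.enorm_heatL1_sub_le ht (hc_pos t ht) h₀ h₁, ?_, ?_, ?_⟩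
  · intro μ₀ μ₁ _ _ h₀ h₁ t ht
    obtain ⟨ν₀, hν₀⟩ := hc.exists_signedMeasure hgrowth ht (hc_pos t ht) h₀
    obtain ⟨ν₁, hν₁⟩ := hc.exists_signedMeasure hgrowth ht (hc_pos t ht) h₁
    have hd := (hc.isDualHeat hgrowth ht (hc_pos t ht) h₀ hν₀).sub
      (hc.isDualHeat hgrowth ht (hc_pos t ht) h₁ hν₁)
    refine ⟨⟨_, hd, fun ν hν => hν.eq hd⟩, ?_⟩
    rw [hd.dualHeat_eq]
    obtain ⟨P, hP, e⟩ := MetricHeat.exists_variation_univ_eq (ν₀ - ν₁)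
    rw [e]
    exact hc.ofReal_sub_compl_le_W1 ht (hc_pos t ht) hν₀ hν₁ hP
  · intro x t ht
    obtain ⟨ν, -, hd, e⟩ := hdirac x t ht
    exact ⟨⟨ν, hd, fun ν' hν' => hν'.eq hd⟩, hint x t, hd.dualHeat_eq.trans e⟩
  · intro x y t ht
    obtain ⟨ν, hν, -, e⟩ := hdirac x t ht
    obtain ⟨ν', hν', -, e'⟩ := hdirac y t ht
    set g := MetricHeat.heatKernel m t x - MetricHeat.heatKernel m t y
    have hg : Integrable g m := (hint x t).sub (hint y t)
    have hgm : Measurable g :=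
      (SignedMeasure.measurable_rnDeriv _ _).sub (SignedMeasure.measurable_rnDeriv _ _)
    have hP : MeasurableSet {z | 0 ≤ g z} := measurableSet_le measurable_const hgm
    have hd : ν - ν' = m.withDensityᵥ g := by rw [e, e', withDensityᵥ_sub (hint x t) (hint y t)]
    have hsplit : ∫ z, MetricHeat.signFn {y | 0 ≤ g y} z * g z ∂m =
        (ν - ν') {z | 0 ≤ g z} - (ν - ν') {z | 0 ≤ g z}ᶜ := by
      rw [hd, withDensityᵥ_apply hg hP, withDensityᵥ_apply hg hP.compl, ← integral_indicator hP,
        ← integral_indicator hP.compl, ← integral_sub (hg.indicator hP) (hg.indicator hP.compl)]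
      congr 1 with z
      by_cases hz : 0 ≤ g z <;> simp [MetricHeat.signFn, hz]
    rw [MetricHeat.eLpNorm_one_eq_integral_signFn hg, hsplit,
      ENNReal.ofReal_mul (hc_pos t ht).le]
    exact (hc.ofReal_sub_compl_le_W1 ht (hc_pos t ht) hν hν' hP).trans
      (mul_le_mul_right (MetricHeat.W1_dirac_le x y) _)
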